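/- Let $r \ge 1$. An $r$-graph is a pair $G=(V,E)$ with $V$ a finite set of vertices and $E$ a set of $r$-element subsets of $V$, called edges (graphs without edges or without vertices are allowed). For a possibly infinite family $\mathcal F$ of $r$-graphs, an $r$-graph $G$ is $\mathcal F$-free if there is no $F\in\mathcal F$ for which there exists an injective map $V(F)\to V(G)$ sending edges of $F$ to edges of $G$. Let $\mathrm{ex}(n,\mathcal F)$ be the maximum number of edges of an $\mathcal F$-free $r$-graph on $n$ vertices (and $\mathrm{ex}(n,\mathcal F)=0$ if there is none). The Turán density of $\mathcal F$ is $\pi(\mathcal F)=\lim_{n\to\infty}\mathrm{ex}(n,\mathcal F)/\binom nr$, and $\Pi_\infty^{(r)}\subseteq[0,1]$ denotes the set of the Turán densities $\pi(\mathcal F)$ of all possibly infinite families $\mathcal F$ of $r$-graphs. **Corollary.** For any integer $r\ge 2$ the following statements are equivalent: (i) $\Pi_\infty^{(r)}$ has positive Lebesgue measure. (ii) $\Pi_\infty^{(r)}$ contains a nonempty open interval. (iii) For every integer $r'\ge r$, $\Pi_\infty^{(r')}$ has positive Lebesgue measure. (iv) For every integer $r'\ge r$, $\Pi_\infty^{(r')}$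 contains a nonempty open interval. -/

import Mathlib

open Filter Topology MeasureTheory

/-- A (simple) `r`-graph on the vertex set `V`: a finite set of edges, each of which is an
`r`-element set of vertices. Graphs without edges or without vertices are allowed. -/
@[ext]
structure RGraph (r : ℕ) (V : Type*) where
  edges : Finset (Finset V)
  card_eq : ∀ e ∈ edges, e.card = r

/-- `F` is a subgraph of `G` (up to isomorphism): there is an embedding of `F` into `G`, that is,
an injective map of the vertices which maps edges to edges. -/
def RGraph.IsSubgraph {r : ℕ} {V W : Type*} (F : RGraph r V) (G : RGraph r W) : Prop :=
  ∃ f : V ↪ W, ∀ e ∈ F.edges, e.map f ∈ G.edges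

/-- A (possibly infinite, possibly empty) family of finite `r`-graphs. Finite `r`-graphs are taken
up to isomorphism, with vertex set `Fin m` for some `m`. -/
abbrev RFamily (r : ℕ) : Type := Set (Σ m : ℕ, RGraph r (Fin m))

/-- `G` is `𝓕`-free: no member of `𝓕` is a subgraph of `G`. -/
def RGraph.IsFree {r : ℕ} {W : Type*} (G : RGraph r W) (𝓕 : RFamily r) : Prop :=
  ∀ F ∈ 𝓕, ¬ F.2.IsSubgraph G

/-- The Turán function `ex(n, 𝓕)`: the maximum number of edges of an `𝓕`-free `r`-graph on `n`
vertices. The set is bounded, so the supremum is a maximum whenever an `𝓕`-free `r`-graph on `n`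
vertices exists; otherwise it is `0`. -/
noncomputable def turanEx {r : ℕ} (n : ℕ) (𝓕 : RFamily r) : ℕ :=
  sSup {k : ℕ | ∃ G : RGraph r (Fin n), G.IsFree 𝓕 ∧ G.edges.card = k}

/-- `α` is the Turán density of `𝓕`, i.e. `α = lim ex(n, 𝓕) / (n choose r)` as `n → ∞`. -/
def IsTuranDensity {r : ℕ} (𝓕 : RFamily r) (α : ℝ) : Prop :=
  Tendsto (fun n : ℕ => (turanEx n 𝓕 : ℝ) / (n.choose r : ℝ)) atTop (𝓝 α)

/-- The set of all Turán densities of (possibly infinite) families of `r`-graphs. -/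
def turanDensities (r : ℕ) : Set ℝ :=
  {α : ℝ | ∃ 𝓕 : RFamily r, IsTuranDensity 𝓕 α}

/-- `S` contains a (nonempty) open interval. -/
def ContainsOpenInterval (S : Set ℝ) : Prop :=
  ∃ a b : ℝ, a < b ∧ Set.Ioo a b ⊆ S

/-!
The implications "interval ⟹ positive measure" and "all `r' ≥ r` ⟹ `r`" are clear, so two facts
are needed. Throughout, a class of `r`-graphs that is closed under subgraphs is the class of graphs
free of some (infinite) family, namely of the family of all graphs outside the class
(`isFree_familyOf_iff`). Hence a density can be realised by describing such a class.

*Positive measure passes from `r` to `r + 1`.* Given `𝓕`, consider the `(r + 1)`-graphs with a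
vertex set `S` such that each edge has exactly one vertex outside `S` and the links of the outer
vertices are `𝓕`-free on `S`. On `n` vertices they have at most `max_k ex(k, 𝓕) * (n - k)` edges,
with equality attained, so their density is a positive constant times that of `𝓕`
(`exists_mul_mem_turanDensities_succ`).

*Positive measure yields an interval.* Given two classes of densities `α` and `β`, consider the
graphs whose vertex set splits into two parts inducing members of the respective classes. All edges
meeting both parts are allowed, so the density is the maximum of
`1 - (1 - α) x ^ r - (1 - β) (1 - x) ^ r` over `x ∈ [0, 1]`. In the coordinate
`t = (1 - α) ^ (-1 / (r - 1))` this operation is addition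
(`one_sub_inv_pow_add_mem_turanDensities`). A sumset `A + A` with `A` measurable of positive measure
contains an interval by Steinhaus' theorem, and the change of coordinates is a diffeomorphism.

That the set of densities is measurable is not evident, so its volume is a priori only an outer
measure. The set is however the image of a Borel subset of the Cantor space of
all families under a Borel map, hence analytic (`analyticSet_turanDensities`), and an
analytic set of positive outer measure contains a compact set of positive measure
(`MeasureTheory.AnalyticSet.exists_isCompact_measure_pos`).
-/

/-! ### Sumsets and analytic sets -/

open scoped Pointwise in
/-- A form of Steinhaus' theorem for sumsets. -/
theorem exists_ball_subset_add_self {A : Set ℝ} (hA : MeasurableSet A) (hpos : 0 < volume A) :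
    ∃ t : ℝ, ∃ ε > 0, Metric.ball t ε ⊆ A + A := by
  -- Some reflection `t - A` meets `A` in positive measure; otherwise Fubini makes `A` null.
  obtain ⟨t, ht⟩ : ∃ t : ℝ, 0 < volume (A ∩ (fun x => t - x) ⁻¹' A) := by
    by_contra! h
    have hm : MeasurableSet {p : ℝ × ℝ | p.1 ∈ A ∧ p.2 - p.1 ∈ A} :=
      (measurable_fst hA).inter ((measurable_snd.sub measurable_fst) hA)
    have h0 : (volume.prod volume) {p : ℝ × ℝ | p.1 ∈ A ∧ p.2 - p.1 ∈ A} = 0 := by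
      rw [Measure.prod_apply_symm hm]
      refine (lintegral_congr fun t => ?_).trans lintegral_zero
      exact le_antisymm (h t) bot_le
    have h1 := Measure.measure_ae_null_of_prod_null h0
    refine hpos.ne' (measure_mono_null (fun x hx => ?_) h1)
    have : Prod.mk x ⁻¹' {p : ℝ × ℝ | p.1 ∈ A ∧ p.2 - p.1 ∈ A} = (fun y => y - x) ⁻¹' A := by
      ext y; simp [hx]
    simp only [Set.mem_compl_iff, Set.mem_ofPred_eq, this, Pi.zero_apply]
    simp only [sub_eq_add_neg, measure_preimage_add_right]
    exact hpos.ne'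
  have hm : MeasurableSet (A ∩ (fun x => t - x) ⁻¹' A) :=
    hA.inter ((measurable_const.sub measurable_id) hA)
  obtain ⟨ε, hε, hsub⟩ := Metric.mem_nhds_iff.1
    (Measure.sub_mem_nhds_zero_of_addHaar_pos volume _ hm ht)
  refine ⟨t, ε, hε, fun y hy => ?_⟩
  have hy' : y - t ∈ Metric.ball (0 : ℝ) ε := by
    simpa [Real.dist_eq] using hy
  obtain ⟨d, hd, d', hd', h⟩ := hsub hy'
  refine ⟨d, hd.1, t - d', hd'.2, ?_⟩
  simp only at h ⊢
  linarith

/-- A weak form of Choquet's capacitability theorem: an analytic set of positive outer measure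
contains a compact set of positive measure. -/
theorem MeasureTheory.AnalyticSet.exists_isCompact_measure_pos {X : Type*} [TopologicalSpace X]
    [MeasurableSpace X] {μ : Measure X} [μ.OuterRegular] {s : Set X}
    (hs : AnalyticSet s) (hpos : 0 < μ s) : ∃ K ⊆ s, IsCompact K ∧ 0 < μ K := by
  rw [AnalyticSet] at hs
  rcases hs with rfl | ⟨f, hf, rfl⟩
  · simp at hpos
  obtain ⟨c, hc0, hc⟩ := exists_between hpos
  -- Bounding the coordinates one after the other, the image keeps outer measure greater than `c`.
  have step : ∀ (k : ℕ) (S : Set (ℕ → ℕ)), ∃ m : ℕ, c < μ (f '' S) →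
      c < μ (f '' (S ∩ {x | x k ≤ m})) := by
    intro k S
    by_cases hS : c < μ (f '' S)
    · have hmono : Monotone fun m : ℕ => f '' (S ∩ {x | x k ≤ m}) := fun m m' h =>
        Set.image_mono (Set.inter_subset_inter_right _ fun x (hx : x k ≤ m) => hx.trans h)
      have hU : f '' S = ⋃ m : ℕ, f '' (S ∩ {x | x k ≤ m}) := by
        rw [← Set.image_iUnion, ← Set.inter_iUnion]
        congr 1
        refine (Set.inter_eq_left.2 fun x _ => ?_).symm
        exact Set.mem_iUnion.2 ⟨x k, (le_rfl : x k ≤ x k)⟩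
      rw [hU, hmono.measure_iUnion, lt_iSup_iff] at hS
      obtain ⟨m, hm⟩ := hS
      exact ⟨m, fun _ => hm⟩
    · exact ⟨0, fun h => absurd h hS⟩
  choose m hm using step
  let S : ℕ → Set (ℕ → ℕ) := fun k => Nat.rec Set.univ (fun k S => S ∩ {x | x k ≤ m k S}) k
  let b : ℕ → ℕ := fun k => m k (S k)
  have hSpos : ∀ k, c < μ (f '' S k) := by
    intro k
    induction k with
    | zero => simpa [S] using hc
    | succ k ih => exact hm k (S k) ih
  have hSmem : ∀ k x, x ∈ S k ↔ ∀ i < k, x i ≤ b i := by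
    intro k x
    induction k with
    | zero => simp [S]
    | succ k ih =>
      have : x ∈ S (k + 1) ↔ x ∈ S k ∧ x k ≤ b k := Iff.rfl
      rw [this, ih, Nat.forall_lt_succ_right]
  let K : Set (ℕ → ℕ) := Set.univ.pi fun i => Set.Iic (b i)
  have hK : IsCompact K := isCompact_univ_pi fun i => (Set.finite_Iic _).isCompact
  refine ⟨f '' K, Set.image_subset_range _ _, hK.image hf, hc0.trans_le ?_⟩
  -- Every open neighbourhood of `f '' K` contains some `f '' S k`, by compactness of `K`.
  rw [Set.measure_eq_iInf_isOpen]
  refine le_iInf₂ fun U hKU => le_iInf fun hU => ?_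
  suffices h : ∃ k, f '' S k ⊆ U by
    obtain ⟨k, hk⟩ := h
    exact (hSpos k).le.trans (measure_mono hk)
  by_contra! h
  have h' : ∀ k, ∃ x ∈ S k, f x ∉ U := fun k => by
    obtain ⟨_, ⟨x, hx, rfl⟩, hxU⟩ := Set.not_subset.1 (h k)
    exact ⟨x, hx, hxU⟩
  choose x hxS hxU using h'
  have hyK : ∀ k, (fun i => min (x k i) (b i)) ∈ K := fun k i _ => Set.mem_Iic.2 (min_le_right _ _)
  obtain ⟨y, hyK', φ, hφ, hlim⟩ := hK.tendsto_subseq hyK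
  have hxlim : Tendsto (x ∘ φ) atTop (𝓝 y) := by
    rw [tendsto_pi_nhds] at hlim ⊢
    intro i
    refine (hlim i).congr' ?_
    filter_upwards [eventually_gt_atTop i] with k hk
    exact min_eq_left ((hSmem _ _).1 (hxS (φ k)) i (hk.trans_le hφ.le_apply))
  have hyU : f y ∈ Uᶜ := hU.isClosed_compl.mem_of_tendsto ((hf.tendsto y).comp hxlim)
    (Eventually.of_forall fun k => hxU (φ k))
  exact hyU (hKU ⟨y, hyK', rfl⟩)

/-! ### Free graphs and the Turán function -/

namespace RGraph

variable {r : ℕ} {U V W : Type*}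

theorem IsSubgraph.refl (F : RGraph r V) : F.IsSubgraph F :=
  ⟨Function.Embedding.refl V, fun e he => by simpa using he⟩

theorem ext_edges_injective : Function.Injective (edges : RGraph r V → Finset (Finset V)) :=
  fun _ _ => RGraph.ext

instance [Finite V] : Finite (RGraph r V) := Finite.of_injective _ ext_edges_injective

theorem card_edges_le {n : ℕ} (G : RGraph r (Fin n)) : G.edges.card ≤ n.choose r := by
  have h : G.edges ⊆ Finset.powersetCard r Finset.univ := fun e he =>
    Finset.mem_powersetCard_univ.2 (G.card_eq e he)
  simpa using Finset.card_le_card h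

/-- `FreeOn 𝓕 S E` says that no member of `𝓕` embeds into the hypergraph with edge set `E` in such
a way that all its vertices are mapped into `S`. Vertices of members of `𝓕` may be isolated, so
this depends on `S` and not only on the edges contained in `S`. -/
def FreeOn (𝓕 : RFamily r) (S : Finset W) (E : Set (Finset W)) : Prop :=
  ∀ F ∈ 𝓕, ¬ ∃ f : Fin F.1 ↪ W, (∀ i, f i ∈ S) ∧ ∀ e ∈ F.2.edges, e.map f ∈ E

/-- Freeness is inherited along an embedding `f`, provided that the edges contained in `S` are
mapped to edges. -/
theorem FreeOn.of_embedding {𝓕 : RFamily r} {S : Finset V} {T : Finset W}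
    {D : Set (Finset V)} {E : Set (Finset W)} (h : FreeOn 𝓕 T E) (f : V ↪ W)
    (hST : ∀ v ∈ S, f v ∈ T)
    (hDE : ∀ e ⊆ S, e.card = r → e ∈ D → e.map f ∈ E) : FreeOn 𝓕 S D := by
  rintro F hF ⟨g, hgS, hg⟩
  refine h F hF ⟨g.trans f, fun i => hST _ (hgS i), fun e he => ?_⟩
  rw [← Finset.map_map]
  refine hDE _ (fun v hv => ?_) (by rw [Finset.card_map, F.2.card_eq e he]) (hg e he)
  obtain ⟨i, -, rfl⟩ := Finset.mem_map.1 hv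
  exact hgS i

theorem FreeOn.mono {𝓕 : RFamily r} {S : Finset V} {D E : Set (Finset V)} (h : FreeOn 𝓕 S E)
    (hDE : ∀ e ⊆ S, e.card = r → e ∈ D → e ∈ E) : FreeOn 𝓕 S D :=
  h.of_embedding (Function.Embedding.refl V) (fun _ => id)
    (fun e he hr hD => by simpa using hDE e he hr hD)

end RGraph

open RGraph

section TuranFunction

variable {r n : ℕ} {𝓕 : RFamily r}

theorem RGraph.IsFree.card_le_turanEx {G : RGraph r (Fin n)} (hG : G.IsFree 𝓕) :
    G.edges.card ≤ turanEx n 𝓕 :=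
  le_csSup ⟨n.choose r, by rintro _ ⟨G, -, rfl⟩; exact G.card_edges_le⟩ ⟨G, hG, rfl⟩

theorem exists_isFree_card_eq_turanEx (h : ∃ G : RGraph r (Fin n), G.IsFree 𝓕) :
    ∃ G : RGraph r (Fin n), G.IsFree 𝓕 ∧ G.edges.card = turanEx n 𝓕 := by
  obtain ⟨G, hG⟩ := h
  exact Nat.sSup_mem (s := {k : ℕ | ∃ G : RGraph r (Fin n), G.IsFree 𝓕 ∧ G.edges.card = k})
    ⟨_, G, hG, rfl⟩ ⟨n.choose r, by rintro _ ⟨G, -, rfl⟩; exact G.card_edges_le⟩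

theorem turanEx_eq_zero (h : ∀ G : RGraph r (Fin n), ¬ G.IsFree 𝓕) : turanEx n 𝓕 = 0 := by
  have : {k : ℕ | ∃ G : RGraph r (Fin n), G.IsFree 𝓕 ∧ G.edges.card = k} = ∅ := by
    ext k; simp [h]
  rw [turanEx, this, csSup_empty]; rfl

theorem turanEx_le_choose (n : ℕ) (𝓕 : RFamily r) : turanEx n 𝓕 ≤ n.choose r := by
  by_cases h : ∃ G : RGraph r (Fin n), G.IsFree 𝓕
  · obtain ⟨G, -, hG⟩ := exists_isFree_card_eq_turanEx h
    exact hG ▸ G.card_edges_le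
  · push Not at h
    rw [turanEx_eq_zero h]; exact Nat.zero_le _

theorem RGraph.FreeOn.card_le_turanEx {S : Finset (Fin n)} {E : Finset (Finset (Fin n))}
    (hE : ∀ e ∈ E, e ⊆ S ∧ e.card = r) (h : FreeOn 𝓕 S (E : Set (Finset (Fin n)))) :
    E.card ≤ turanEx S.card 𝓕 := by
  classical
  let f : Fin S.card ↪ Fin n := (S.orderEmbOfFin rfl).toEmbedding
  have hfS : ∀ i, f i ∈ S := fun i => S.orderEmbOfFin_mem rfl i
  have hf : Set.range f = S := S.range_orderEmbOfFin rfl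
  let G : RGraph r (Fin S.card) :=
    { edges := Finset.univ.filter fun e => e.map f ∈ E
      card_eq := fun e he => by
        simpa using (hE _ (Finset.mem_filter.1 he).2).2 }
  have hG : G.IsFree 𝓕 := by
    rintro F hF ⟨g, hg⟩
    refine h F hF ⟨g.trans f, fun i => hfS _, fun e he => ?_⟩
    rw [← Finset.map_map]
    exact (Finset.mem_filter.1 (hg e he)).2
  refine le_trans ?_ hG.card_le_turanEx
  have hsub : E ⊆ G.edges.image (Finset.map f) := by
    intro e he
    have hr : (e : Set (Fin n)) ⊆ Set.range f := by
      rw [hf]; exact_mod_cast (hE e he).1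
    have hmap : (e.preimage f f.injective.injOn).map f = e := by
      rw [Finset.map_eq_image, Finset.image_preimage]
      exact Finset.filter_true_of_mem fun x hx => hr hx
    exact Finset.mem_image.2 ⟨_, Finset.mem_filter.2 ⟨Finset.mem_univ _, by rwa [hmap]⟩, hmap⟩
  exact (Finset.card_le_card hsub).trans Finset.card_image_le

theorem exists_freeOn_card_eq_turanEx (S : Finset (Fin n))
    (h : ∃ G : RGraph r (Fin S.card), G.IsFree 𝓕) :
    ∃ E : Finset (Finset (Fin n)), (∀ e ∈ E, e ⊆ S ∧ e.card = r) ∧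
      FreeOn 𝓕 S (E : Set (Finset (Fin n))) ∧ E.card = turanEx S.card 𝓕 := by
  obtain ⟨G, hG, hcard⟩ := exists_isFree_card_eq_turanEx h
  let f : Fin S.card ↪ Fin n := (S.orderEmbOfFin rfl).toEmbedding
  have hfS : ∀ i, f i ∈ S := fun i => S.orderEmbOfFin_mem rfl i
  have hf : Set.range f = S := S.range_orderEmbOfFin rfl
  refine ⟨G.edges.map (Finset.mapEmbedding f).toEmbedding, fun e he => ?_, ?_, by simp [hcard]⟩
  · obtain ⟨d, hd, rfl⟩ := Finset.mem_map.1 he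
    refine ⟨fun v hv => ?_, by simpa using G.card_eq d hd⟩
    obtain ⟨i, -, rfl⟩ := Finset.mem_map.1 (show v ∈ d.map f from hv)
    exact hfS i
  · rintro F hF ⟨g, hgS, hg⟩
    have hinv : ∀ i, ∃ j, f j = g i := fun i => by
      have : g i ∈ Set.range f := by rw [hf]; exact hgS i
      exact this
    choose k hk using hinv
    let k' : Fin F.1 ↪ Fin S.card := ⟨k, fun i j hij => g.injective (by rw [← hk, ← hk, hij])⟩
    have hg' : g = k'.trans f := by ext i; exact congrArg Fin.val (hk i).symm
    refine hG F hF ⟨k', fun e he => ?_⟩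
    have := hg e he
    rw [hg', ← Finset.map_map] at this
    obtain ⟨d, hd, hde⟩ := Finset.mem_map.1 (Finset.mem_coe.1 this)
    rwa [← Finset.map_injective f hde]

/-- Freeness for a family all of whose members have an edge is satisfied by edgeless graphs. -/
theorem exists_isFree_of_edges_nonempty (h : ∀ F ∈ 𝓕, F.2.edges.Nonempty) (n : ℕ) :
    ∃ G : RGraph r (Fin n), G.IsFree 𝓕 := by
  refine ⟨⟨∅, by simp⟩, ?_⟩
  rintro F hF ⟨f, hf⟩
  obtain ⟨e, he⟩ := h F hF
  exact absurd (hf e he) (Finset.notMem_empty _)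

/-- A density is always realised by a family whose members all have an edge: otherwise the family
excludes all large graphs, the density is `0`, and the family of all graphs with an edge works. -/
theorem IsTuranDensity.exists_edges_nonempty {α : ℝ} (h : IsTuranDensity 𝓕 α) :
    ∃ 𝓖 : RFamily r, IsTuranDensity 𝓖 α ∧ ∀ F ∈ 𝓖, F.2.edges.Nonempty := by
  by_cases hF : ∀ F ∈ 𝓕, F.2.edges.Nonempty
  · exact ⟨𝓕, h, hF⟩
  push Not at hF
  obtain ⟨F, hF, hempty⟩ := hF
  have h0 : ∀ᶠ n in atTop, turanEx n 𝓕 = 0 := by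
    filter_upwards [eventually_ge_atTop F.1] with n hn
    refine turanEx_eq_zero fun G hG => hG F hF ⟨Fin.castLEEmb hn, fun e he => ?_⟩
    simp [hempty] at he
  have hα : α = 0 := by
    refine tendsto_nhds_unique h (tendsto_const_nhds.congr' ?_)
    filter_upwards [h0] with n hn
    simp [hn]
  refine ⟨{F | F.2.edges.Nonempty}, ?_, fun F hF => hF⟩
  have hz : ∀ n, turanEx n ({F | F.2.edges.Nonempty} : RFamily r) = 0 := by
    intro n
    obtain ⟨G, hG, hcard⟩ := exists_isFree_card_eq_turanEx
      (exists_isFree_of_edges_nonempty (𝓕 := {F | F.2.edges.Nonempty}) (fun F hF => hF) n)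
    rw [← hcard, Finset.card_eq_zero]
    by_contra hne
    exact hG ⟨n, G⟩ (Finset.nonempty_iff_ne_empty.2 hne) (IsSubgraph.refl G)
  simp only [IsTuranDensity, hz, hα, Nat.cast_zero, zero_div]
  exact tendsto_const_nhds

end TuranFunction

/-- The family of all finite graphs violating `P`. If `P` is inherited by subgraphs then the graphs
free of this family are exactly those satisfying `P`. -/
def familyOf {r : ℕ} (P : ∀ n, RGraph r (Fin n) → Prop) : RFamily r := {F | ¬ P F.1 F.2}

theorem isFree_familyOf_iff {r : ℕ} {P : ∀ n, RGraph r (Fin n) → Prop}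
    (hP : ∀ m n (F : RGraph r (Fin m)) (G : RGraph r (Fin n)), F.IsSubgraph G → P n G → P m F)
    {n : ℕ} (G : RGraph r (Fin n)) : G.IsFree (familyOf P) ↔ P n G := by
  refine ⟨fun h => ?_, fun h F hF hFG => hF (hP _ _ _ _ hFG h)⟩
  by_contra hG
  exact h ⟨n, G⟩ hG (IsSubgraph.refl G)

/-! ### Joins -/

/-- The vertex set splits into a part on which `G` is `𝓕`-free and a part on which it is
`𝓖`-free. -/
def IsJoin {r : ℕ} (𝓕 𝓖 : RFamily r) (n : ℕ) (G : RGraph r (Fin n)) : Prop :=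
  ∃ S : Finset (Fin n), FreeOn 𝓕 S (G.edges : Set (Finset (Fin n))) ∧
    FreeOn 𝓖 Sᶜ (G.edges : Set (Finset (Fin n)))

theorem IsJoin.of_isSubgraph {r : ℕ} {𝓕 𝓖 : RFamily r} (m n : ℕ) (F : RGraph r (Fin m))
    (G : RGraph r (Fin n)) (hFG : F.IsSubgraph G) (hG : IsJoin 𝓕 𝓖 n G) : IsJoin 𝓕 𝓖 m F := by
  classical
  obtain ⟨f, hf⟩ := hFG
  obtain ⟨S, h1, h2⟩ := hG
  refine ⟨Finset.univ.filter fun v => f v ∈ S, ?_, ?_⟩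
  · exact h1.of_embedding f (fun v hv => (Finset.mem_filter.1 hv).2) fun e _ _ he => hf e he
  · exact h2.of_embedding f (fun v hv => by simpa using hv) fun e _ _ he => hf e he

/-- The `r`-sets that meet both `S` and its complement. -/
def crossing (r : ℕ) {n : ℕ} (S : Finset (Fin n)) : Finset (Finset (Fin n)) :=
  (Finset.powersetCard r Finset.univ).filter fun e => ¬ e ⊆ S ∧ ¬ e ⊆ Sᶜ

/-- An `r`-set lies in `S`, lies in `Sᶜ`, or is crossing, in an exclusive way when `r > 0`. -/
theorem card_filter_add_card_filter_add {r : ℕ} (hr : 0 < r) {n : ℕ} (S : Finset (Fin n))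
    {E : Finset (Finset (Fin n))} (hE : ∀ e ∈ E, e.card = r) :
    E.card = (E.filter (· ⊆ S)).card + (E.filter (· ⊆ Sᶜ)).card +
      (E ∩ crossing r S).card := by
  rw [← Finset.card_union_of_disjoint, ← Finset.card_union_of_disjoint]
  · congr 1
    ext e
    simp only [crossing, Finset.mem_union, Finset.mem_filter, Finset.mem_inter,
      Finset.mem_powersetCard_univ]
    constructor
    · intro he
      have := hE e he
      tauto
    · tauto
  · rw [Finset.disjoint_left]
    intro e he
    simp only [crossing, Finset.mem_union, Finset.mem_filter, Finset.mem_inter] at he ⊢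
    tauto
  · rw [Finset.disjoint_left]
    intro e he he'
    have h1 := (Finset.mem_filter.1 he).2
    have h2 := (Finset.mem_filter.1 he').2
    have h3 := hE e (Finset.mem_filter.1 he).1
    have : e ⊆ S ∩ Sᶜ := Finset.subset_inter h1 h2
    rw [Finset.inter_compl, Finset.subset_empty] at this
    rw [this] at h3
    simp at h3
    omega

theorem choose_eq_add_card_crossing {r : ℕ} (hr : 0 < r) {n : ℕ} (S : Finset (Fin n)) :
    n.choose r = S.card.choose r + (n - S.card).choose r + (crossing r S).card := by
  have h := card_filter_add_card_filter_add hr S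
    (E := Finset.powersetCard r Finset.univ) fun e he => (Finset.mem_powersetCard.1 he).2
  have hT : ∀ T : Finset (Fin n),
      ((Finset.powersetCard r Finset.univ).filter (· ⊆ T)).card = T.card.choose r := by
    intro T
    rw [← Finset.card_powersetCard]
    congr 1
    ext e
    simp [Finset.mem_powersetCard, and_comm]
  have hc : Finset.powersetCard r Finset.univ ∩ crossing r S = crossing r S :=
    Finset.inter_eq_right.2 (Finset.filter_subset _ _)
  rw [hT, hT, hc, Finset.card_compl] at h
  simpa using h

theorem card_edges_le_of_isJoin {r : ℕ} (hr : 0 < r) {𝓕 𝓖 : RFamily r} {n : ℕ}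
    {G : RGraph r (Fin n)} (hG : IsJoin 𝓕 𝓖 n G) :
    ∃ k ≤ n, G.edges.card + k.choose r + (n - k).choose r ≤
      turanEx k 𝓕 + turanEx (n - k) 𝓖 + n.choose r := by
  obtain ⟨S, h1, h2⟩ := hG
  refine ⟨S.card, by simpa using S.card_le_univ, ?_⟩
  have hc := card_filter_add_card_filter_add hr S G.card_eq
  have hn := choose_eq_add_card_crossing hr S
  have hx : (G.edges ∩ crossing r S).card ≤ (crossing r S).card :=
    Finset.card_le_card Finset.inter_subset_right
  have hs : (G.edges.filter (· ⊆ S)).card ≤ turanEx S.card 𝓕 :=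
    FreeOn.card_le_turanEx
      (fun e he => ⟨(Finset.mem_filter.1 he).2, G.card_eq e (Finset.mem_filter.1 he).1⟩)
      (h1.mono fun e _ _ he => (Finset.mem_filter.1 he).1)
  have hs' : (G.edges.filter (· ⊆ Sᶜ)).card ≤ turanEx Sᶜ.card 𝓖 :=
    FreeOn.card_le_turanEx
      (fun e he => ⟨(Finset.mem_filter.1 he).2, G.card_eq e (Finset.mem_filter.1 he).1⟩)
      (h2.mono fun e _ _ he => (Finset.mem_filter.1 he).1)
  rw [Finset.card_compl, Fintype.card_fin] at hs'
  omega

theorem exists_isJoin_card_edges {r : ℕ} (hr : 0 < r) {𝓕 𝓖 : RFamily r}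
    (h𝓕 : ∀ F ∈ 𝓕, F.2.edges.Nonempty) (h𝓖 : ∀ F ∈ 𝓖, F.2.edges.Nonempty) {n k : ℕ}
    (hk : k ≤ n) :
    ∃ G : RGraph r (Fin n), IsJoin 𝓕 𝓖 n G ∧ G.edges.card + k.choose r + (n - k).choose r =
      turanEx k 𝓕 + turanEx (n - k) 𝓖 + n.choose r := by
  classical
  obtain ⟨S, -, hS⟩ := Finset.exists_subset_card_eq (s := (Finset.univ : Finset (Fin n)))
    (n := k) (by simpa using hk)
  obtain ⟨D, hD, hDfree, hDcard⟩ :=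
    exists_freeOn_card_eq_turanEx S (exists_isFree_of_edges_nonempty h𝓕 _)
  obtain ⟨E, hE, hEfree, hEcard⟩ :=
    exists_freeOn_card_eq_turanEx Sᶜ (exists_isFree_of_edges_nonempty h𝓖 _)
  have hcr : ∀ e ∈ crossing r S, (¬ e ⊆ S ∧ ¬ e ⊆ Sᶜ) ∧ e.card = r := fun e he =>
    ⟨(Finset.mem_filter.1 he).2, (Finset.mem_powersetCard.1 (Finset.mem_filter.1 he).1).2⟩
  have hexcl : ∀ e : Finset (Fin n), e ⊆ S → e ⊆ Sᶜ → e.card = r → False := by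
    intro e h1 h2 h3
    have : e ⊆ S ∩ Sᶜ := Finset.subset_inter h1 h2
    rw [Finset.inter_compl, Finset.subset_empty] at this
    rw [this] at h3
    simp at h3
    omega
  let G : RGraph r (Fin n) :=
    { edges := D ∪ E ∪ crossing r S
      card_eq := fun e he => by
        simp only [Finset.mem_union] at he
        rcases he with (he | he) | he
        exacts [(hD e he).2, (hE e he).2, (hcr e he).2] }
  refine ⟨G, ⟨S, hDfree.mono fun e heS her he => ?_, hEfree.mono fun e heS her he => ?_⟩, ?_⟩
  · rcases Finset.mem_union.1 (Finset.mem_coe.1 he) with he | he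
    · rcases Finset.mem_union.1 he with he | he
      · exact he
      · exact (hexcl e heS (hE e he).1 her).elim
    · exact ((hcr e he).1.1 heS).elim
  · rcases Finset.mem_union.1 (Finset.mem_coe.1 he) with he | he
    · rcases Finset.mem_union.1 he with he | he
      · exact (hexcl e (hD e he).1 heS her).elim
      · exact he
    · exact ((hcr e he).1.2 heS).elim
  · have h1 : Disjoint D E := Finset.disjoint_left.2 fun e he he' =>
      hexcl e (hD e he).1 (hE e he').1 (hD e he).2
    have h2 : Disjoint (D ∪ E) (crossing r S) := Finset.disjoint_left.2 fun e he he' => by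
      rcases Finset.mem_union.1 he with he | he
      · exact (hcr e he').1.1 (hD e he).1
      · exact (hcr e he').1.2 (hE e he).1
    have hn := choose_eq_add_card_crossing hr S
    rw [Finset.card_compl, Fintype.card_fin] at hEcard
    rw [hS] at hn hDcard hEcard
    have : G.edges.card = D.card + E.card + (crossing r S).card := by
      rw [← Finset.card_union_of_disjoint h1, ← Finset.card_union_of_disjoint h2]
    omega

/-! ### Cones -/

/-- There is a vertex set `S` such that each edge has exactly one vertex outside `S`, and the
link of each vertex outside `S` is `𝓕`-free on `S`. -/
def IsCone {r : ℕ} (𝓕 : RFamily r) (n : ℕ) (G : RGraph (r + 1) (Fin n)) : Prop :=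
  ∃ S : Finset (Fin n), (∀ e ∈ G.edges, ∃ v ∉ S, ∃ t ⊆ S, insert v t = e) ∧
    ∀ v ∉ S, FreeOn 𝓕 S {t | insert v t ∈ G.edges}

theorem IsCone.of_isSubgraph {r : ℕ} {𝓕 : RFamily r} (m n : ℕ) (F : RGraph (r + 1) (Fin m))
    (G : RGraph (r + 1) (Fin n)) (hFG : F.IsSubgraph G) (hG : IsCone 𝓕 n G) :
    IsCone 𝓕 m F := by
  classical
  obtain ⟨f, hf⟩ := hFG
  obtain ⟨S, h1, h2⟩ := hG
  refine ⟨Finset.univ.filter fun v => f v ∈ S, fun e he => ?_, fun v hv => ?_⟩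
  · obtain ⟨w, hw, t, ht, hwt⟩ := h1 _ (hf e he)
    obtain ⟨v, hve, rfl⟩ := Finset.mem_map.1 (hwt ▸ Finset.mem_insert_self w t)
    refine ⟨v, by simpa using hw, e.erase v, fun u hu => ?_, Finset.insert_erase hve⟩
    have hu' := Finset.mem_erase.1 hu
    have : f u ∈ insert (f v) t := hwt ▸ Finset.mem_map_of_mem f hu'.2
    rcases Finset.mem_insert.1 this with h | h
    · exact absurd (f.injective h) hu'.1
    · simpa using ht h
  · refine (h2 (f v) (by simpa using hv)).of_embedding f (fun u hu => by simpa using hu)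
      fun e _ _ he => ?_
    have := hf _ he
    rwa [Finset.map_insert] at this

theorem card_edges_le_of_isCone {r : ℕ} {𝓕 : RFamily r} {n : ℕ}
    {G : RGraph (r + 1) (Fin n)} (hG : IsCone 𝓕 n G) :
    ∃ k ≤ n, G.edges.card ≤ turanEx k 𝓕 * (n - k) := by
  classical
  obtain ⟨S, h1, h2⟩ := hG
  refine ⟨S.card, by simpa using S.card_le_univ, ?_⟩
  let link : Fin n → Finset (Finset (Fin n)) := fun v =>
    S.powerset.filter fun t => insert v t ∈ G.edges
  have hlink : ∀ v ∈ Sᶜ, (link v).card ≤ turanEx S.card 𝓕 := by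
    intro v hv
    have hv' : v ∉ S := by simpa using hv
    refine FreeOn.card_le_turanEx (fun t ht => ?_)
      ((h2 v hv').mono fun t _ _ ht => (Finset.mem_filter.1 ht).2)
    have ht' := Finset.mem_filter.1 ht
    have hS := Finset.mem_powerset.1 ht'.1
    have := G.card_eq _ ht'.2
    rw [Finset.card_insert_of_notMem fun h => hv' (hS h)] at this
    exact ⟨hS, by omega⟩
  have hsub : G.edges ⊆ Sᶜ.biUnion fun v => (link v).image (insert v) := by
    intro e he
    obtain ⟨v, hv, t, ht, rfl⟩ := h1 e he
    exact Finset.mem_biUnion.2 ⟨v, by simpa using hv, Finset.mem_image.2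
      ⟨t, Finset.mem_filter.2 ⟨Finset.mem_powerset.2 ht, he⟩, rfl⟩⟩
  calc G.edges.card ≤ _ := Finset.card_le_card hsub
    _ ≤ Sᶜ.card * turanEx S.card 𝓕 := Finset.card_biUnion_le_card_mul _ _ _ fun v hv =>
        Finset.card_image_le.trans (hlink v hv)
    _ = turanEx S.card 𝓕 * (n - S.card) := by
        rw [Finset.card_compl, Fintype.card_fin, mul_comm]

theorem exists_isCone_card_edges {r : ℕ} {𝓕 : RFamily r}
    (h𝓕 : ∀ F ∈ 𝓕, F.2.edges.Nonempty) {n k : ℕ} (hk : k ≤ n) :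
    ∃ G : RGraph (r + 1) (Fin n), IsCone 𝓕 n G ∧ G.edges.card = turanEx k 𝓕 * (n - k) := by
  classical
  obtain ⟨S, -, hS⟩ := Finset.exists_subset_card_eq (s := (Finset.univ : Finset (Fin n)))
    (n := k) (by simpa using hk)
  obtain ⟨D, hD, hDfree, hDcard⟩ :=
    exists_freeOn_card_eq_turanEx S (exists_isFree_of_edges_nonempty h𝓕 _)
  -- A vertex outside `S` and a subset of `S` can be recovered from their union.
  have hinj : ∀ v ∉ S, ∀ t ⊆ S, ∀ w ∉ S, ∀ u ⊆ S, insert v t = insert w u → v = w ∧ t = u := by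
    intro v hv t ht w hw u hu h
    have hvw : v = w := by
      have : v ∈ insert w u := h ▸ Finset.mem_insert_self v t
      rcases Finset.mem_insert.1 this with h | h
      exacts [h, absurd (hu h) hv]
    subst hvw
    refine ⟨rfl, ?_⟩
    rw [← Finset.erase_insert (fun h => hv (ht h)), h, Finset.erase_insert (fun h => hv (hu h))]
  let G : RGraph (r + 1) (Fin n) :=
    { edges := (D ×ˢ Sᶜ).image fun p => insert p.2 p.1
      card_eq := fun e he => by
        obtain ⟨⟨t, v⟩, hp, rfl⟩ := Finset.mem_image.1 he
        obtain ⟨ht, hv⟩ := Finset.mem_product.1 hp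
        have hv' : v ∉ S := by simpa using hv
        rw [Finset.card_insert_of_notMem fun h => hv' ((hD t ht).1 h), (hD t ht).2] }
  refine ⟨G, ⟨S, fun e he => ?_, fun v hv => hDfree.mono fun t htS _ ht => ?_⟩, ?_⟩
  · obtain ⟨⟨t, v⟩, hp, rfl⟩ := Finset.mem_image.1 he
    obtain ⟨ht, hv⟩ := Finset.mem_product.1 hp
    exact ⟨v, by simpa using hv, t, (hD t ht).1, rfl⟩
  · obtain ⟨⟨u, w⟩, hp, h⟩ := Finset.mem_image.1 (show insert v t ∈ G.edges from ht)
    obtain ⟨hu, hw⟩ := Finset.mem_product.1 hp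
    rw [Finset.mem_coe,
      ← (hinj w (by simpa using hw) u (hD u hu).1 v hv t htS h).2]
    exact hu
  · have : G.edges.card = (D ×ˢ Sᶜ).card := by
      refine Finset.card_image_of_injOn ?_
      rintro ⟨t, v⟩ hp ⟨u, w⟩ hq h
      obtain ⟨ht, hv⟩ := Finset.mem_product.1 (Finset.mem_coe.1 hp)
      obtain ⟨hu, hw⟩ := Finset.mem_product.1 (Finset.mem_coe.1 hq)
      obtain ⟨h1, h2⟩ := hinj v (by simpa using hv) t (hD t ht).1 w (by simpa using hw) u
        (hD u hu).1 h
      exact Prod.ext h2 h1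
    rw [this, Finset.card_product, Finset.card_compl, Fintype.card_fin, hDcard, hS]

/-! ### Asymptotics -/

theorem tendsto_choose_div_pow (r : ℕ) :
    Tendsto (fun n : ℕ => (n.choose r : ℝ) / (n : ℝ) ^ r) atTop (𝓝 (1 / r.factorial)) := by
  have h := (Asymptotics.isEquivalent_iff_tendsto_one (u := fun n : ℕ => (n.choose r : ℝ))
    (v := fun n : ℕ => (n : ℝ) ^ r / r.factorial) (l := atTop) ?_).1 (isEquivalent_choose r)
  · have := h.div_const (r.factorial : ℝ)
    refine this.congr fun n => ?_
    have := r.factorial_ne_zero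
    simp only [Pi.div_apply]
    field_simp
  · filter_upwards [eventually_gt_atTop 0] with n hn
    positivity

theorem tendsto_div_pow_iff_tendsto_div_choose {f : ℕ → ℝ} {r : ℕ} {α : ℝ} :
    Tendsto (fun n => f n / (n : ℝ) ^ r) atTop (𝓝 (α / r.factorial)) ↔
      Tendsto (fun n => f n / (n.choose r : ℝ)) atTop (𝓝 α) := by
  have hc := tendsto_choose_div_pow r
  have hf : (r.factorial : ℝ) ≠ 0 := by exact_mod_cast r.factorial_ne_zero
  have hne : ∀ᶠ n : ℕ in atTop, (n.choose r : ℝ) ≠ 0 ∧ (n : ℝ) ^ r ≠ 0 := by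
    filter_upwards [eventually_ge_atTop r, eventually_gt_atTop 0] with n hn hn0
    exact ⟨by exact_mod_cast (Nat.choose_pos hn).ne', by positivity⟩
  constructor <;> intro h
  · have := h.div hc (by positivity)
    rw [div_div_div_cancel_right₀ hf, div_one] at this
    refine this.congr' ?_
    filter_upwards [hne] with n hn
    exact div_div_div_cancel_right₀ hn.2 _ _
  · have := h.mul hc
    rw [mul_one_div] at this
    refine this.congr' ?_
    filter_upwards [hne] with n hn
    exact div_mul_div_cancel₀ hn.1

/-- A sequence asymptotic to `a * m ^ r` is, for all `m ≤ n` at once, within `o(n ^ r)`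
of `a * m ^ r`. -/
theorem eventually_forall_le_abs_sub_le {f : ℕ → ℝ} {r : ℕ} (hr : 0 < r) {a : ℝ}
    (h : Tendsto (fun n => f n / (n : ℝ) ^ r) atTop (𝓝 a)) {ε : ℝ} (hε : 0 < ε) :
    ∀ᶠ n : ℕ in atTop, ∀ m ≤ n, |f m - a * (m : ℝ) ^ r| ≤ ε * (n : ℝ) ^ r := by
  obtain ⟨N, hN⟩ := Metric.tendsto_atTop.1 h ε hε
  let C := ∑ m ∈ Finset.range (N + 1), |f m - a * (m : ℝ) ^ r|
  have hlarge : ∀ᶠ n : ℕ in atTop, C / ε ≤ (n : ℝ) ^ r :=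
    ((tendsto_pow_atTop hr.ne').comp tendsto_natCast_atTop_atTop).eventually_ge_atTop _
  filter_upwards [hlarge] with n hn m hm
  by_cases hmN : m ≤ N
  · have h1 : |f m - a * (m : ℝ) ^ r| ≤ C :=
      Finset.single_le_sum (f := fun m : ℕ => |f m - a * (m : ℝ) ^ r|)
        (fun _ _ => abs_nonneg _) (Finset.mem_range.2 (Nat.lt_succ_of_le hmN))
    have h2 : C ≤ (n : ℝ) ^ r * ε := (div_le_iff₀ hε).1 hn
    linarith
  · have hm0 : (0 : ℝ) < (m : ℝ) ^ r := by
      have : 0 < m := by omega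
      positivity
    have h1 := hN m (by omega)
    rw [Real.dist_eq] at h1
    have h2 : |f m - a * (m : ℝ) ^ r| = |f m / (m : ℝ) ^ r - a| * (m : ℝ) ^ r := by
      rw [← abs_of_pos hm0, ← abs_mul, abs_of_pos hm0, sub_mul, div_mul_cancel₀ _ hm0.ne']
    have h3 : (m : ℝ) ^ r ≤ (n : ℝ) ^ r := by gcongr
    rw [h2]
    exact mul_le_mul h1.le h3 hm0.le hε.le

/-- If `u n` is the maximum over `k ≤ n` of quantities `h n k ≈ g (k / n) * n ^ s`, then
`u n / n ^ s` tends to the maximum of `g` over `[0, 1]`. -/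
theorem tendsto_div_pow_of_isMaxOn {u : ℕ → ℝ} {h : ℕ → ℕ → ℝ} {g : ℝ → ℝ} {s : ℕ} {x : ℝ}
    (hg : Continuous g) (hx : x ∈ Set.Icc (0 : ℝ) 1) (hmax : ∀ y ∈ Set.Icc (0 : ℝ) 1, g y ≤ g x)
    (hle : ∀ n, ∀ k ≤ n, h n k ≤ u n) (hex : ∀ n, ∃ k ≤ n, u n ≤ h n k)
    (happrox : ∀ ε > 0, ∀ᶠ n : ℕ in atTop, ∀ k ≤ n,
      |h n k - g ((k : ℝ) / n) * (n : ℝ) ^ s| ≤ ε * (n : ℝ) ^ s) :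
    Tendsto (fun n => u n / (n : ℝ) ^ s) atTop (𝓝 (g x)) := by
  rw [Metric.tendsto_nhds]
  intro ε hε
  have hfloor : Tendsto (fun n : ℕ => g ((⌊x * n⌋₊ : ℝ) / n)) atTop (𝓝 (g x)) :=
    (hg.tendsto x).comp ((tendsto_nat_floor_mul_div_atTop hx.1).comp tendsto_natCast_atTop_atTop)
  filter_upwards [happrox (ε / 3) (by positivity), eventually_gt_atTop 0,
    Metric.tendsto_nhds.1 hfloor (ε / 3) (by positivity)] with n hn hn0 hfl
  have hn0' : (0 : ℝ) < n := by exact_mod_cast hn0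
  have hp : (0 : ℝ) < (n : ℝ) ^ s := by positivity
  rw [Real.dist_eq] at hfl ⊢
  have hkn : ⌊x * n⌋₊ ≤ n := Nat.floor_le_of_le (by nlinarith [hx.2])
  have hlow : g x - 2 * ε / 3 ≤ u n / (n : ℝ) ^ s := by
    rw [le_div_iff₀ hp]
    have h1 := (abs_le.1 (hn _ hkn)).1
    have h2 := hle n _ hkn
    have h3 := (abs_lt.1 hfl).1
    have h4 : (g x - ε / 3) * (n : ℝ) ^ s ≤ g ((⌊x * n⌋₊ : ℝ) / n) * (n : ℝ) ^ s :=
      mul_le_mul_of_nonneg_right (by linarith) hp.le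
    linarith
  have hup : u n / (n : ℝ) ^ s ≤ g x + ε / 3 := by
    rw [div_le_iff₀ hp]
    obtain ⟨k, hk, hku⟩ := hex n
    have h1 := (abs_le.1 (hn k hk)).2
    have hkn' : (k : ℝ) ≤ n := by exact_mod_cast hk
    have h2 := hmax ((k : ℝ) / n) ⟨by positivity, div_le_one_of_le₀ hkn' hn0'.le⟩
    have h3 := mul_le_mul_of_nonneg_right h2 hp.le
    linarith
  rw [abs_lt]
  constructor <;> linarith

/-- The number of edges of a join with parts of sizes `k` and `n - k`, uniformly in `k ≤ n`. -/
theorem join_approx {e₁ e₂ : ℕ → ℝ} {r : ℕ} (hr : 0 < r) {α β : ℝ}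
    (h₁ : Tendsto (fun n => e₁ n / (n.choose r : ℝ)) atTop (𝓝 α))
    (h₂ : Tendsto (fun n => e₂ n / (n.choose r : ℝ)) atTop (𝓝 β)) {ε : ℝ} (hε : 0 < ε) :
    ∀ᶠ n : ℕ in atTop, ∀ k ≤ n,
      |(e₁ k + e₂ (n - k) + n.choose r - k.choose r - (n - k).choose r) -
        (1 - (1 - α) * ((k : ℝ) / n) ^ r - (1 - β) * (1 - (k : ℝ) / n) ^ r) / r.factorial *
          (n : ℝ) ^ r| ≤ ε * (n : ℝ) ^ r := by
  have hε5 : 0 < ε / 5 := by positivity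
  have hc := eventually_forall_le_abs_sub_le hr (tendsto_choose_div_pow r) hε5
  have ha := eventually_forall_le_abs_sub_le hr
    (tendsto_div_pow_iff_tendsto_div_choose.2 h₁) hε5
  have hb := eventually_forall_le_abs_sub_le hr
    (tendsto_div_pow_iff_tendsto_div_choose.2 h₂) hε5
  filter_upwards [hc, ha, hb, eventually_gt_atTop 0] with n hc ha hb hn k hk
  have hn0 : (n : ℝ) ≠ 0 := by exact_mod_cast hn.ne'
  have hcast : ((n - k : ℕ) : ℝ) = n - k := Nat.cast_sub hk
  have i1 := abs_le.1 (ha k hk)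
  have i2 := abs_le.1 (hb (n - k) (Nat.sub_le _ _))
  have i3 := abs_le.1 (hc n le_rfl)
  have i4 := abs_le.1 (hc k hk)
  have i5 := abs_le.1 (hc (n - k) (Nat.sub_le _ _))
  rw [hcast] at i2 i5
  have key : (1 - (1 - α) * ((k : ℝ) / n) ^ r - (1 - β) * (1 - (k : ℝ) / n) ^ r) / r.factorial *
      (n : ℝ) ^ r = α / r.factorial * (k : ℝ) ^ r + β / r.factorial * ((n : ℝ) - k) ^ r +
        1 / r.factorial * (n : ℝ) ^ r - 1 / r.factorial * (k : ℝ) ^ r -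
        1 / r.factorial * ((n : ℝ) - k) ^ r := by
    have e1 : (k : ℝ) ^ r = ((k : ℝ) / n) ^ r * (n : ℝ) ^ r := by
      rw [← mul_pow, div_mul_cancel₀ _ hn0]
    have e2 : ((n : ℝ) - k) ^ r = (1 - (k : ℝ) / n) ^ r * (n : ℝ) ^ r := by
      rw [← mul_pow, sub_mul, div_mul_cancel₀ _ hn0, one_mul]
    rw [e1, e2]
    ring
  rw [key, abs_le]
  constructor <;> linarith [i1.1, i1.2, i2.1, i2.2, i3.1, i3.2, i4.1, i4.2, i5.1, i5.2]

/-- The number of edges of a cone with `k` inner and `n - k` outer vertices, uniformly in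
`k ≤ n`. -/
theorem cone_approx {e : ℕ → ℝ} {r : ℕ} (hr : 0 < r) {α : ℝ}
    (h : Tendsto (fun n => e n / (n.choose r : ℝ)) atTop (𝓝 α)) {ε : ℝ} (hε : 0 < ε) :
    ∀ᶠ n : ℕ in atTop, ∀ k ≤ n,
      |e k * (n - k : ℕ) - α / r.factorial * (((k : ℝ) / n) ^ r * (1 - (k : ℝ) / n)) *
          (n : ℝ) ^ (r + 1)| ≤ ε * (n : ℝ) ^ (r + 1) := by
  have ha := eventually_forall_le_abs_sub_le hr (tendsto_div_pow_iff_tendsto_div_choose.2 h) hε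
  filter_upwards [ha, eventually_gt_atTop 0] with n ha hn k hk
  have hn0 : (n : ℝ) ≠ 0 := by exact_mod_cast hn.ne'
  have key : e k * (n - k : ℕ) - α / r.factorial * (((k : ℝ) / n) ^ r * (1 - (k : ℝ) / n)) *
      (n : ℝ) ^ (r + 1) = (e k - α / r.factorial * (k : ℝ) ^ r) * (n - k : ℕ) := by
    have e1 : (k : ℝ) ^ r = ((k : ℝ) / n) ^ r * (n : ℝ) ^ r := by
      rw [← mul_pow, div_mul_cancel₀ _ hn0]
    have e2 : ((n - k : ℕ) : ℝ) = (1 - (k : ℝ) / n) * n := by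
      rw [Nat.cast_sub hk, sub_mul, div_mul_cancel₀ _ hn0, one_mul]
    rw [e1, e2]
    ring
  rw [key, abs_mul, Nat.abs_cast, pow_succ, ← mul_assoc]
  have : ((n - k : ℕ) : ℝ) ≤ n := by exact_mod_cast Nat.sub_le n k
  gcongr
  exact ha k hk

/-! ### Operations on Turán densities -/

theorem mem_Icc_of_mem_turanDensities {r : ℕ} {α : ℝ} (h : α ∈ turanDensities r) :
    α ∈ Set.Icc (0 : ℝ) 1 := by
  obtain ⟨𝓕, h⟩ := h
  refine ⟨ge_of_tendsto' h fun n => by positivity, le_of_tendsto' h fun n => ?_⟩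
  exact div_le_one_of_le₀ (by exact_mod_cast turanEx_le_choose n 𝓕) (by positivity)

theorem exists_isFree_familyOf_card_eq {r n : ℕ} {P : ∀ n, RGraph r (Fin n) → Prop}
    (hP : ∀ m n (F : RGraph r (Fin m)) (G : RGraph r (Fin n)), F.IsSubgraph G → P n G → P m F)
    (h : ∃ G, P n G) : ∃ G, P n G ∧ G.edges.card = turanEx n (familyOf P) := by
  simp only [← isFree_familyOf_iff hP] at h ⊢
  exact exists_isFree_card_eq_turanEx h

/-- The density of a join of classes of densities `α` and `β`, the parts having sizes `x * n` and
`(1 - x) * n` with the best possible `x`. -/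
theorem one_sub_mem_turanDensities {r : ℕ} (hr : 0 < r) {α β : ℝ} (hα : α ∈ turanDensities r)
    (hβ : β ∈ turanDensities r) {x : ℝ} (hx : x ∈ Set.Icc (0 : ℝ) 1)
    (hmin : ∀ y ∈ Set.Icc (0 : ℝ) 1,
      (1 - α) * x ^ r + (1 - β) * (1 - x) ^ r ≤ (1 - α) * y ^ r + (1 - β) * (1 - y) ^ r) :
    1 - (1 - α) * x ^ r - (1 - β) * (1 - x) ^ r ∈ turanDensities r := by
  obtain ⟨𝓕', h𝓕'⟩ := hα
  obtain ⟨𝓕, hα, h𝓕⟩ := h𝓕'.exists_edges_nonempty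
  obtain ⟨𝓖', h𝓖'⟩ := hβ
  obtain ⟨𝓖, hβ, h𝓖⟩ := h𝓖'.exists_edges_nonempty
  refine ⟨familyOf (IsJoin 𝓕 𝓖), tendsto_div_pow_iff_tendsto_div_choose.1 ?_⟩
  refine tendsto_div_pow_of_isMaxOn
    (g := fun y => (1 - (1 - α) * y ^ r - (1 - β) * (1 - y) ^ r) / r.factorial)
    (h := fun n k => turanEx k 𝓕 + turanEx (n - k) 𝓖 + n.choose r - k.choose r -
      (n - k).choose r) (by fun_prop) hx (fun y hy => ?_) (fun n k hk => ?_) (fun n => ?_)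
    (fun ε hε => join_approx hr hα hβ hε)
  · have := hmin y hy
    refine div_le_div_of_nonneg_right ?_ (by positivity)
    linarith
  · obtain ⟨G, hG, hcard⟩ := exists_isJoin_card_edges hr h𝓕 h𝓖 hk
    have hle := ((isFree_familyOf_iff IsJoin.of_isSubgraph G).2 hG).card_le_turanEx
    have : turanEx k 𝓕 + turanEx (n - k) 𝓖 + n.choose r ≤
        turanEx n (familyOf (IsJoin 𝓕 𝓖)) + k.choose r + (n - k).choose r := by omega
    have : (turanEx k 𝓕 + turanEx (n - k) 𝓖 + n.choose r : ℝ) ≤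
        turanEx n (familyOf (IsJoin 𝓕 𝓖)) + k.choose r + (n - k).choose r := by
      exact_mod_cast this
    linarith
  · obtain ⟨G₀, hG₀, -⟩ := exists_isJoin_card_edges hr h𝓕 h𝓖 (Nat.zero_le n)
    obtain ⟨G, hG, hcard⟩ := exists_isFree_familyOf_card_eq IsJoin.of_isSubgraph ⟨G₀, hG₀⟩
    obtain ⟨k, hk, hle⟩ := card_edges_le_of_isJoin hr hG
    refine ⟨k, hk, ?_⟩
    rw [hcard] at hle
    have : (turanEx n (familyOf (IsJoin 𝓕 𝓖)) + k.choose r + (n - k).choose r : ℝ) ≤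
        turanEx k 𝓕 + turanEx (n - k) 𝓖 + n.choose r := by
      exact_mod_cast hle
    linarith

/-- In the coordinate `t = (1 - α) ^ (-1 / q)`, where `r = q + 1`, the join of two classes
corresponds to addition. -/
theorem one_sub_inv_pow_add_mem_turanDensities {q : ℕ} {s t : ℝ} (hs : 0 < s) (ht : 0 < t)
    (hs' : 1 - (s ^ q)⁻¹ ∈ turanDensities (q + 1)) (ht' : 1 - (t ^ q)⁻¹ ∈ turanDensities (q + 1)) :
    1 - ((s + t) ^ q)⁻¹ ∈ turanDensities (q + 1) := by
  have hst : 0 < s + t := add_pos hs ht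
  have hx : s / (s + t) ∈ Set.Icc (0 : ℝ) 1 :=
    ⟨by positivity, div_le_one_of_le₀ (by linarith) hst.le⟩
  have h1x : 1 - s / (s + t) = t / (s + t) := by field_simp; ring
  have hval : (s ^ q)⁻¹ * (s / (s + t)) ^ (q + 1) + (t ^ q)⁻¹ * (1 - s / (s + t)) ^ (q + 1) =
      ((s + t) ^ q)⁻¹ := by
    rw [h1x]
    simp only [div_pow, pow_succ]
    field_simp
  have h := one_sub_mem_turanDensities (Nat.succ_pos q) hs' ht' hx fun y hy => by
    simp only [sub_sub_cancel]
    rw [hval]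
    -- Jensen's inequality for the power `q + 1` at the points `y / s` and `(1 - y) / t`
    have hj := (convexOn_pow (𝕜 := ℝ) (q + 1)).2
      (Set.mem_Ici.2 (div_nonneg hy.1 hs.le))
      (Set.mem_Ici.2 (div_nonneg (sub_nonneg.2 hy.2) ht.le))
      (div_nonneg hs.le hst.le) (div_nonneg ht.le hst.le) (by field_simp)
    simp only [smul_eq_mul] at hj
    have e1 : s / (s + t) * (y / s) + t / (s + t) * ((1 - y) / t) = 1 / (s + t) := by
      field_simp; ring
    have e2 : s / (s + t) * (y / s) ^ (q + 1) + t / (s + t) * ((1 - y) / t) ^ (q + 1) =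
        ((s ^ q)⁻¹ * y ^ (q + 1) + (t ^ q)⁻¹ * (1 - y) ^ (q + 1)) / (s + t) := by
      simp only [div_pow, pow_succ]
      field_simp
    rw [e1, e2, le_div_iff₀ hst] at hj
    refine le_trans (le_of_eq ?_) hj
    simp only [div_pow, pow_succ, one_pow]
    field_simp
  simp only [sub_sub_cancel] at h
  rwa [sub_sub, hval] at h

/-- Cones embed a scaled copy of the densities of `r`-graphs into those of `(r + 1)`-graphs. -/
theorem exists_mul_mem_turanDensities_succ {r : ℕ} (hr : 0 < r) :
    ∃ c : ℝ, 0 < c ∧ ∀ α ∈ turanDensities r, c * α ∈ turanDensities (r + 1) := by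
  obtain ⟨x, hx, hmax⟩ := isCompact_Icc.exists_isMaxOn (Set.nonempty_Icc.2 (zero_le_one' ℝ))
    (f := fun y : ℝ => y ^ r * (1 - y)) (by fun_prop)
  have hpos : 0 < x ^ r * (1 - x) := by
    have h2 : (2⁻¹ : ℝ) ^ r * (1 - 2⁻¹) ≤ x ^ r * (1 - x) :=
      hmax (show (2⁻¹ : ℝ) ∈ Set.Icc (0 : ℝ) 1 by constructor <;> norm_num)
    refine lt_of_lt_of_le ?_ h2
    norm_num
  refine ⟨(r + 1) * (x ^ r * (1 - x)), by positivity, fun α hα => ?_⟩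
  have hα0 := (mem_Icc_of_mem_turanDensities hα).1
  obtain ⟨𝓕', h𝓕'⟩ := hα
  obtain ⟨𝓕, hα, h𝓕⟩ := h𝓕'.exists_edges_nonempty
  refine ⟨familyOf (IsCone 𝓕), tendsto_div_pow_iff_tendsto_div_choose.1 ?_⟩
  have hval : (r + 1) * (x ^ r * (1 - x)) * α / (r + 1).factorial =
      α / r.factorial * (x ^ r * (1 - x)) := by
    rw [Nat.factorial_succ]
    push_cast
    field_simp
  rw [hval]
  refine tendsto_div_pow_of_isMaxOn (g := fun y => α / r.factorial * (y ^ r * (1 - y)))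
    (h := fun n k => turanEx k 𝓕 * (n - k : ℕ)) (by fun_prop) hx (fun y hy => ?_)
    (fun n k hk => ?_) (fun n => ?_) (fun ε hε => cone_approx hr hα hε)
  · exact mul_le_mul_of_nonneg_left (hmax hy) (by positivity)
  · obtain ⟨G, hG, hcard⟩ := exists_isCone_card_edges h𝓕 hk
    have hle := ((isFree_familyOf_iff IsCone.of_isSubgraph G).2 hG).card_le_turanEx
    rw [hcard] at hle
    exact_mod_cast hle
  · obtain ⟨G₀, hG₀, -⟩ := exists_isCone_card_edges h𝓕 (Nat.zero_le n)
    obtain ⟨G, hG, hcard⟩ := exists_isFree_familyOf_card_eq IsCone.of_isSubgraph ⟨G₀, hG₀⟩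
    obtain ⟨k, hk, hle⟩ := card_edges_le_of_isCone hG
    refine ⟨k, hk, ?_⟩
    rw [hcard] at hle
    exact_mod_cast hle

theorem volume_turanDensities_succ_pos {r : ℕ} (hr : 0 < r) (h : 0 < volume (turanDensities r)) :
    0 < volume (turanDensities (r + 1)) := by
  obtain ⟨c, hc, hsub⟩ := exists_mul_mem_turanDensities_succ hr
  have himg : (c • ·) '' turanDensities r ⊆ turanDensities (r + 1) := by
    rintro _ ⟨α, hα, rfl⟩
    exact hsub α hα
  refine lt_of_lt_of_le ?_ (measure_mono himg)
  rw [Set.image_smul, Measure.addHaar_smul]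
  refine ENNReal.mul_pos ?_ h.ne'
  simpa using hc.ne'

/-! ### The set of Turán densities is analytic -/

/-- The family with a given indicator function. This identifies the families with the points of
a Polish space. -/
def familyOfIndicator {r : ℕ} (w : (Σ m : ℕ, RGraph r (Fin m)) → Bool) : RFamily r :=
  {F | w F = true}

theorem measurable_turanEx (r n : ℕ) :
    Measurable fun w : (Σ m : ℕ, RGraph r (Fin m)) → Bool => turanEx n (familyOfIndicator w) := by
  have hfree : Measurable fun (w : (Σ m : ℕ, RGraph r (Fin m)) → Bool)
      (G : RGraph r (Fin n)) => G.IsFree (familyOfIndicator w) := by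
    refine measurable_pi_lambda _ fun G => measurableSet_setOfPred.1 ?_
    have : {w : (Σ m : ℕ, RGraph r (Fin m)) → Bool | G.IsFree (familyOfIndicator w)} =
        ⋂ F : Σ m : ℕ, RGraph r (Fin m), {w | w F = true → ¬ F.2.IsSubgraph G} := by
      ext w
      simp [IsFree, familyOfIndicator]
    rw [this]
    refine MeasurableSet.iInter fun F => ?_
    have hF : Measurable fun w : (Σ m : ℕ, RGraph r (Fin m)) → Bool => w F :=
      measurable_pi_apply F
    exact hF (MeasurableSet.of_discrete (s := {b : Bool | b = true → ¬ F.2.IsSubgraph G}))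
  exact (Measurable.of_discrete (f := fun p : RGraph r (Fin n) → Prop =>
    sSup {k : ℕ | ∃ G, p G ∧ G.edges.card = k})).comp hfree

theorem analyticSet_turanDensities (r : ℕ) : AnalyticSet (turanDensities r) := by
  let ρ : ℕ → ((Σ m : ℕ, RGraph r (Fin m)) → Bool) → ℝ := fun n w =>
    (turanEx n (familyOfIndicator w) : ℝ) / (n.choose r : ℝ)
  have hρ : ∀ n, Measurable (ρ n) := fun n =>
    (measurable_from_top.comp (measurable_turanEx r n)).div_const _
  have hC : MeasurableSet {w | ∃ c, Tendsto (ρ · w) atTop (𝓝 c)} :=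
    measurableSet_exists_tendsto fun n => hρ n
  -- The upper limit is a measurable function on all families that extends the limit.
  have hlim : Measurable fun w => limsup (ρ · w) atTop := Measurable.limsup hρ
  convert hC.analyticSet_image hlim using 1
  ext α
  constructor
  · classical
    rintro ⟨𝓕, h⟩
    have hw : familyOfIndicator (fun F => decide (F ∈ 𝓕)) = 𝓕 := by
      ext F; simp [familyOfIndicator]
    have h' : Tendsto (ρ · fun F => decide (F ∈ 𝓕)) atTop (𝓝 α) := by
      simp only [ρ, hw]; exact h
    exact ⟨_, ⟨α, h'⟩, h'.limsup_eq⟩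
  · rintro ⟨w, ⟨c, hc⟩, rfl⟩
    simp only [hc.limsup_eq]
    exact ⟨familyOfIndicator w, hc⟩

/-! ### From positive measure to an interval -/

open scoped Pointwise in
/-- Steinhaus' theorem for `A + A`, read through `φ t = 1 - t ^ (-(r - 1))`, which turns addition
into the formation of joins. -/
theorem containsOpenInterval_turanDensities {r : ℕ} (hr : 2 ≤ r)
    (h : 0 < volume (turanDensities r)) : ContainsOpenInterval (turanDensities r) := by
  obtain ⟨q, rfl⟩ : ∃ q, r = q + 1 := ⟨r - 1, by omega⟩
  have hq : q ≠ 0 := by omega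
  obtain ⟨K, hKsub, hK, hKpos⟩ := (analyticSet_turanDensities _).exists_isCompact_measure_pos h
  let φ : ℝ → ℝ := fun t => 1 - (t ^ q)⁻¹
  have hφmono : StrictMonoOn φ (Set.Ioi 0) := fun s hs t ht hst =>
    sub_lt_sub_left (inv_strictAnti₀ (pow_pos hs q) (pow_lt_pow_left₀ hst (le_of_lt hs) hq)) 1
  have hφdiff : DifferentiableOn ℝ φ (Set.Ioi 0) := fun t ht =>
    ((differentiableAt_pow q).inv (pow_pos ht q).ne').const_sub 1 |>.differentiableWithinAt
  have hφmeas : Measurable φ := by fun_prop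
  have hφsurj : ∀ α < 1, ∃ t ∈ Set.Ioi (0 : ℝ), φ t = α := by
    intro α hα
    have h1 : 0 < 1 - α := sub_pos.2 hα
    refine ⟨((1 - α)⁻¹) ^ ((q : ℝ)⁻¹), Real.rpow_pos_of_pos (inv_pos.2 h1) _, ?_⟩
    simp only [φ]
    rw [Real.rpow_inv_natCast_pow (inv_pos.2 h1).le hq, inv_inv, sub_sub_cancel]
  let A : Set ℝ := φ ⁻¹' K ∩ Set.Ioi 0
  have hA : MeasurableSet A := (hφmeas hK.measurableSet).inter measurableSet_Ioi
  have hApos : 0 < volume A := by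
    rw [pos_iff_ne_zero]
    intro h0
    -- `φ '' A` is `K` without the point `1`, and differentiable images of null sets are null.
    have himg := addHaar_image_eq_zero_of_differentiableOn_of_addHaar_eq_zero volume
      (hφdiff.mono Set.inter_subset_right) h0
    have hKimg : K ⊆ φ '' A ∪ {1} := by
      intro α hα
      rcases (mem_Icc_of_mem_turanDensities (hKsub hα)).2.lt_or_eq with h1 | h1
      · obtain ⟨t, ht, rfl⟩ := hφsurj α h1
        exact Or.inl ⟨t, ⟨hα, ht⟩, rfl⟩
      · exact Or.inr h1
    exact hKpos.ne' (measure_mono_null hKimg (measure_union_null himg (measure_singleton 1)))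
  obtain ⟨t, ε, hε, hball⟩ := exists_ball_subset_add_self hA hApos
  rw [Real.ball_eq_Ioo] at hball
  have hsum : ∀ y ∈ Set.Ioo (t - ε) (t + ε), 0 < y ∧ φ y ∈ turanDensities (q + 1) := by
    intro y hy
    obtain ⟨a, ha, b, hb, rfl⟩ := hball hy
    exact ⟨add_pos ha.2 hb.2,
      one_sub_inv_pow_add_mem_turanDensities ha.2 hb.2 (hKsub ha.1) (hKsub hb.1)⟩
  have ht : t ∈ Set.Ioo (t - ε) (t + ε) := ⟨by linarith, by linarith⟩
  have hu : t + ε / 2 ∈ Set.Ioo (t - ε) (t + ε) := ⟨by linarith, by linarith⟩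
  refine ⟨φ t, φ (t + ε / 2), hφmono (hsum t ht).1 (hsum _ hu).1 (by linarith), ?_⟩
  have hcont : ContinuousOn φ (Set.Icc t (t + ε / 2)) := hφdiff.continuousOn.mono fun y hy =>
    (hsum t ht).1.trans_le hy.1
  intro α hα
  obtain ⟨y, hy, rfl⟩ := intermediate_value_Ioo (by linarith) hcont hα
  exact (hsum y ⟨by linarith [hy.1], by linarith [hy.2]⟩).2

theorem mainTheorem4 (r : ℕ) (hr : 2 ≤ r) :
    List.TFAE [
      0 < volume (turanDensities r),
      ContainsOpenInterval (turanDensities r),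
      ∀ r' : ℕ, r ≤ r' → 0 < volume (turanDensities r'),
      ∀ r' : ℕ, r ≤ r' → ContainsOpenInterval (turanDensities r')] := by
  tfae_have 1 → 3 := fun h r' hr' => by
    induction r', hr' using Nat.le_induction with
    | base => exact h
    | succ k hk ih => exact volume_turanDensities_succ_pos (by omega) ih
  tfae_have 3 → 4 := fun h r' hr' =>
    containsOpenInterval_turanDensities (hr.trans hr') (h r' hr')
  tfae_have 4 → 2 := fun h => h r le_rfl
  tfae_have 2 → 1 := fun ⟨a, b, hab, hsub⟩ => by
    refine lt_of_lt_of_le ?_ (measure_mono hsub)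
    rw [Real.volume_Ioo]
    simpa using hab
  tfae_finish
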